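/- **Theorem (ε-corrector for cycle-freeness).** In the randomized CONGEST model the processors are the vertices of an $n$-vertex graph $G=(V,E)$ (not necessarily connected) and the edges are the communication links. Every processor knows $n$ and $\varepsilon$, its own identifier, its degree and a private string of independent fair random bits, and its links are numbered arbitrarily. The identifiers are distinct integers in $\{0,\dots,n^{\kappa}-1\}$. Computation proceeds in synchronous rounds; in each round each processor performs unrestricted local computation and sends to each neighbour a (possibly different) message of $O(\log n)$ bits. Let $\mathrm{dist}(G,\text{acyclic})$ denote the minimum number of edges whose removal from $G$ leaves an acyclic graph. For all $\kappa,c\in\mathbb{N}$ there is a constant $C>0$ (depending only on $\kappa$ and $c$) such that for every $n$ and every $\varepsilon>0$ there is a randomized CONGEST algorithm with at most $C\,\frac{\log n}{\varepsilon}$ rounds and messages of at most $C\log n$ bits that is an $\varepsilon$-corrector for cycle-freeness with high probability. That is, on every $n$-vertex network $G=(V,E)$ the following hold together, for one set $D\subseteq E$, with probability at least $1-n^{-c}$: 1. when the algorithm terminates, every processor $v$ knows (outputs) which of the edges incident to $v$ belong to $D$; 2. the remaining graph $(V,E\setminus D)$ is acyclic; 3. $|D|\le \mathrm{dist}(G,\text{acyclic})+\varepsilon|E|$;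 4. there are a partition of $V$ into clusters $V_1,\dots,V_k$, each inducing a connected subgraph $G[V_i]$ of diameter at most $C\,\frac{\log n}{\varepsilon}$, and a spanning tree $T_i$ of each $G[V_i]$, such that $D$ consists exactly of all cut edges (edges with ends in different clusters) and all edges inside a cluster $V_i$ that are not edges of $T_i$. -/

import Mathlib

universe u

/-! ### The randomized CONGEST model -/

/-- A synchronous randomized message-passing algorithm, the same program at every processor.
A processor starts with its identifier, its degree and its own finite tape of private random bits;
its links are numbered `0, …, degree - 1` (its ports). In every round each processor first computes
(for each port) a message, a bit string, from its local state; all messages are delivered, and each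
processor updates its state. The empty string is the empty message. After `rounds` rounds each
processor outputs one bit for each of its ports. Local computation is not restricted. -/
structure CongestAlgorithm where
  tapeLength : ℕ
  State : Type
  init : (ident degree : ℕ) → (Fin tapeLength → Bool) → State
  send : State → (port : ℕ) → List Bool
  receive : State → (inbox : ℕ → List Bool) → State
  rounds : ℕ
  output : State → (port : ℕ) → Bool

/-- Every message has at most `b` bits. -/
def CongestAlgorithm.BandwidthAtMost (A : CongestAlgorithm) (b : ℝ) : Prop :=
  ∀ (s : A.State) (p : ℕ), ((A.send s p).length : ℝ) ≤ b

/-- A network: a graph whose vertices are the processors and whose edges are the links, an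
arbitrary numbering of the links at each processor, and distinct identifiers. -/
structure Network (V : Type u) where
  graph : SimpleGraph V
  port : ∀ v : V, Fin (graph.neighborSet v).ncard ≃ graph.neighborSet v
  ident : V → ℕ
  ident_injective : Function.Injective ident

namespace Network

variable {V : Type u} (N : Network V)

/-- The number of links at `v`. -/
noncomputable def degree (v : V) : ℕ := (N.graph.neighborSet v).ncard

/-- If every `u` sends `out u p` through its port `p`, then `N.inbox out v p` is what `v` receives
through its port `p`: the message that the neighbour `u` at that port sends through the port of `u`
which leads to `v`. -/
noncomputable def inbox (out : V → ℕ → List Bool) (v : V) (p : ℕ) : List Bool :=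
  if h : p < (N.graph.neighborSet v).ncard then
    out (N.port v ⟨p, h⟩)
      ((N.port (N.port v ⟨p, h⟩)).symm ⟨v, (N.port v ⟨p, h⟩).2.symm⟩ : Fin _)
  else []

end Network

namespace CongestAlgorithm

variable {V : Type u} (A : CongestAlgorithm) (N : Network V)

/-- The states of all processors after a number of rounds, for given private random tapes. -/
noncomputable def stateAfter (tape : V → Fin A.tapeLength → Bool) : ℕ → V → A.State
  | 0, v => A.init (N.ident v) (N.degree v) (tape v)
  | t + 1, v => A.receive (stateAfter tape t v)
      (N.inbox (fun u => A.send (stateAfter tape t u)) v)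

/-- The final output of the processor `v` at its port `p`. -/
noncomputable def finalOutput (tape : V → Fin A.tapeLength → Bool) (v : V) (p : ℕ) : Bool :=
  A.output (A.stateAfter N tape A.rounds v) p

/-- The probability of an event when all bits of all tapes are independent and fair. -/
noncomputable def tapeProb (event : Set (V → Fin A.tapeLength → Bool)) : ℝ :=
  (event.ncard : ℝ) / (Nat.card (V → Fin A.tapeLength → Bool) : ℝ)

end CongestAlgorithm

/-! ### Graph properties and correction -/

/-- A graph property. -/
def GraphProperty : Type (u + 1) := (V : Type u) → SimpleGraph V → Prop

/-- A property that is preserved by the removal of edges. -/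
def GraphProperty.EdgeMonotone (P : GraphProperty.{u}) : Prop :=
  ∀ (V : Type u) (G G' : SimpleGraph V), G' ≤ G → P V G → P V G'

/-- Cycle-freeness. -/
def CycleFree : GraphProperty.{u} := fun _ G => G.IsAcyclic

theorem cycleFree_edgeMonotone : CycleFree.{u}.EdgeMonotone :=
  fun _ _ _ hle h => SimpleGraph.IsAcyclic.anti hle h

/-- The minimum number of edges that have to be removed from `G` to obtain the property `P`. -/
noncomputable def deletionDist {V : Type u} (P : GraphProperty.{u}) (G : SimpleGraph V) : ℕ :=
  sInf {k : ℕ | ∃ D : Set (Sym2 V), D ⊆ G.edgeSet ∧ P V (G.deleteEdges D) ∧ D.ncard = k}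

/-- For the given random tapes, the run of `A` on the network satisfies the requirements of an
`ε`-corrector for `P` with deleted edge set `D`: every processor outputs which of the edges at it
belong to `D` (so the two ends of an edge agree), the remaining graph has the property, and `D` has
at most `ε |E|` edges more than necessary. -/
def CongestAlgorithm.Corrects {V : Type u} (A : CongestAlgorithm) (N : Network V)
    (P : GraphProperty.{u}) (ε : ℝ) (tape : V → Fin A.tapeLength → Bool)
    (D : Set (Sym2 V)) : Prop :=
  D ⊆ N.graph.edgeSet ∧
  (∀ (v : V) (i : Fin (N.graph.neighborSet v).ncard),
    A.finalOutput N tape v i = true ↔ s(v, (N.port v i : V)) ∈ D) ∧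
  P V (N.graph.deleteEdges D) ∧
  (D.ncard : ℝ) ≤ (deletionDist P N.graph : ℝ) + ε * (N.graph.edgeSet.ncard : ℝ)

/-! ### Clusterings -/

/-- A partition `𝒱` of the vertices into clusters which induce connected subgraphs of diameter at
most `d` (distances are measured inside the cluster). -/
def IsClustering {V : Type u} (G : SimpleGraph V) (𝒱 : Set (Set V)) (d : ℝ) : Prop :=
  Setoid.IsPartition 𝒱 ∧
  ∀ S ∈ 𝒱, (G.induce S).Connected ∧ ∀ u v : S, ((G.induce S).dist u v : ℝ) ≤ d

/-- The edges inside some cluster. -/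
def intraEdges {V : Type u} (G : SimpleGraph V) (𝒱 : Set (Set V)) : Set (Sym2 V) :=
  {e ∈ G.edgeSet | ∃ S ∈ 𝒱, ∀ x ∈ e, x ∈ S}

/-- The cut edges: those with ends in different clusters. -/
def cutEdges {V : Type u} (G : SimpleGraph V) (𝒱 : Set (Set V)) : Set (Sym2 V) :=
  G.edgeSet \ intraEdges G 𝒱

/-- `D` consists of the cut edges of a clustering with diameter at most `d` and of all edges inside
the clusters that do not belong to a chosen spanning tree `T[S]` of the cluster `S`. -/
def IsClusterTreeDeletion {V : Type u} (G : SimpleGraph V) (d : ℝ) (D : Set (Sym2 V)) : Prop :=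
  ∃ (𝒱 : Set (Set V)) (T : SimpleGraph V), IsClustering G 𝒱 d ∧
    T ≤ G ∧ (∀ S ∈ 𝒱, (T.induce S).IsTree) ∧
    D = cutEdges G 𝒱 ∪ (intraEdges G 𝒱 \ T.edgeSet)

/-! The corrector is deterministic. With `ρ = ⌈1 / ε⌉` and `r = 2 * ρ`, it computes a set of roots
which are pairwise at distance more than `r`, grows a breadth-first forest from them and deletes all
edges outside of this forest.

A forest with `k` trees on `n` vertices has `n - k` edges, so the number of deleted edges exceeds
the distance to acyclicity by at most the number of roots minus the number of components of the
graph. Each root that shares its component with another root can be charged with the first `ρ` edges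
of a shortest path to that root. These edges lie within distance `ρ` of it, so no edge is charged
twice, and the excess is at most `|E| / ρ ≤ ε * |E|`.

The roots are found by elimination along the `L = O(log n)` bits of the identifiers: in phase `j`
the candidates whose `j`-th bit is `1` drop out if they are within distance `r` of a candidate whose
`j`-th bit is `0`. Two remaining candidates differ in some bit, so they are more than `r` apart. A
candidate that drops out is within distance `r` of one that stays, so in the end every vertex is
within distance `L * r` of a root. -/

section ForestCounting

open SimpleGraph

variable {V : Type u} {G T : SimpleGraph V}

theorem bijective_sigma_mapEdgeSet (G : SimpleGraph V) :
    Function.Bijective fun x : Σ C : G.ConnectedComponent, C.toSimpleGraph.edgeSet =>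
      x.1.toSimpleGraph_hom.mapEdgeSet x.2 := by
  refine ⟨?_, ?_⟩
  · rintro ⟨C, e, he⟩ ⟨C', e', he'⟩ h
    have hmap : e.map Subtype.val = e'.map Subtype.val := congrArg Subtype.val h
    obtain rfl : C = C' := by
      induction e with | _ a b
      have ha : (a : V) ∈ e'.map Subtype.val := hmap ▸ Sym2.mem_mk_left _ _
      obtain ⟨a', -, haa'⟩ := Sym2.mem_map.1 ha
      exact a.2.symm.trans (haa' ▸ a'.2)
    obtain rfl := Sym2.map.injective Subtype.val_injective hmap
    rfl
  · rintro ⟨e, he⟩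
    induction e with | _ a b
    have hb : G.connectedComponentMk b = G.connectedComponentMk a :=
      (ConnectedComponent.sound he.reachable).symm
    exact ⟨⟨G.connectedComponentMk a, s(⟨a, rfl⟩, ⟨b, hb⟩), he⟩, rfl⟩

theorem ncard_edgeSet_add_card_connectedComponent [Finite V] (hG : G.IsAcyclic) :
    G.edgeSet.ncard + Nat.card G.ConnectedComponent = Nat.card V := by
  have := Fintype.ofFinite G.ConnectedComponent
  have hvert : Nat.card V = ∑ C : G.ConnectedComponent, Nat.card C :=
    (Nat.card_congr (Equiv.sigmaFiberEquiv G.connectedComponentMk).symm).trans Nat.card_sigma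
  have hedge : G.edgeSet.ncard = ∑ C : G.ConnectedComponent, Nat.card C.toSimpleGraph.edgeSet :=
    (Nat.card_congr (.ofBijective _ (bijective_sigma_mapEdgeSet G))).symm.trans Nat.card_sigma
  have htree (C : G.ConnectedComponent) : Nat.card C.toSimpleGraph.edgeSet + 1 = Nat.card C :=
    (isTree_iff_connected_and_card.1 (hG.isTree_connectedComponent C)).2
  rw [hvert, hedge, ← Finset.sum_congr rfl fun C _ => htree C, Finset.sum_add_distrib,
    Finset.sum_const, Finset.card_univ, smul_eq_mul, mul_one, Nat.card_eq_fintype_card]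

theorem ncard_edgeSet_add_card_connectedComponent_le_deletionDist [Finite V] (G : SimpleGraph V) :
    G.edgeSet.ncard + Nat.card G.ConnectedComponent ≤
      deletionDist CycleFree.{u} G + Nat.card V := by
  obtain ⟨D, hD, hforest, hDcard⟩ : deletionDist CycleFree.{u} G ∈ _ :=
    Nat.sInf_mem ⟨_, G.edgeSet, subset_rfl, deleteEdges_eq_bot.2 subset_rfl ▸ isAcyclic_bot, rfl⟩
  have hcount := ncard_edgeSet_add_card_connectedComponent hforest
  have hcomp := ConnectedComponent.card_le_card_of_le (G.deleteEdges_le D)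
  have hedge := Set.ncard_sdiff_add_ncard_of_subset hD
  rw [edgeSet_deleteEdges] at hcount
  omega

theorem ncard_edgeSet_sdiff_add_card_connectedComponent_le [Finite V] (hTG : T ≤ G)
    (hT : T.IsAcyclic) :
    (G.edgeSet \ T.edgeSet).ncard + Nat.card G.ConnectedComponent ≤
      deletionDist CycleFree.{u} G + Nat.card T.ConnectedComponent := by
  have hdist := ncard_edgeSet_add_card_connectedComponent_le_deletionDist G
  have hcount := ncard_edgeSet_add_card_connectedComponent hT
  have hedge := Set.ncard_sdiff_add_ncard_of_subset (edgeSet_mono hTG)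
  omega

theorem isPartition_range_supp (T : SimpleGraph V) :
    Setoid.IsPartition (Set.range (ConnectedComponent.supp (G := T))) := by
  refine ⟨?_, fun v => ⟨(T.connectedComponentMk v).supp, ⟨⟨_, rfl⟩, rfl⟩, ?_⟩⟩
  · rintro ⟨C, hC⟩
    exact C.nonempty_supp.ne_empty hC
  · rintro _ ⟨⟨C, rfl⟩, rfl⟩
    rfl

theorem dist_induce_supp_le (hTG : T ≤ G) (C : T.ConnectedComponent) (u v : C.supp) :
    (G.induce C.supp).dist u v ≤ T.dist u v := by
  classical
  obtain ⟨p, hp⟩ := (C.reachable_of_mem_supp u.2 v.2).exists_walk_length_eq_dist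
  have hsupp : ∀ w ∈ p.support, w ∈ C.supp := fun w hw =>
    (ConnectedComponent.sound (p.takeUntil w hw).reachable).symm.trans u.2
  let q : (T.induce C.supp).Walk u v := p.induce C.supp hsupp
  calc (G.induce C.supp).dist u v
      ≤ (q.mapLe (comap_monotone _ hTG)).length := dist_le _
    _ = (q.map (Embedding.induce C.supp).toHom).length := by
      rw [Walk.length_map, Walk.length_map]
    _ = T.dist u v := (congrArg Walk.length (Walk.map_induce p hsupp)).trans hp

theorem isClusterTreeDeletion_sdiff_edgeSet (hTG : T ≤ G) (hT : T.IsAcyclic) {d : ℝ}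
    (hd : ∀ u v, T.Reachable u v → (T.dist u v : ℝ) ≤ d) :
    IsClusterTreeDeletion G d (G.edgeSet \ T.edgeSet) := by
  have hintra : T.edgeSet ⊆ intraEdges G (Set.range (ConnectedComponent.supp (G := T))) := by
    intro e he
    refine ⟨edgeSet_mono hTG he, ?_⟩
    induction e with | _ a b
    refine ⟨_, ⟨T.connectedComponentMk a, rfl⟩, fun x hx => ?_⟩
    obtain rfl | rfl := Sym2.mem_iff.1 hx
    · rfl
    · exact (ConnectedComponent.sound he.reachable).symm
  refine ⟨_, T, ⟨isPartition_range_supp T, ?_⟩, hTG, ?_, ?_⟩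
  · rintro _ ⟨C, rfl⟩
    exact ⟨C.connected_toSimpleGraph.mono (comap_monotone _ hTG), fun u v =>
      (Nat.cast_le.2 (dist_induce_supp_le hTG C u v)).trans
        (hd u v (C.reachable_of_mem_supp u.2 v.2))⟩
  · rintro _ ⟨C, rfl⟩
    exact hT.isTree_connectedComponent C
  · exact (Set.sdiff_union_sdiff_cancel (Set.sep_subset _ _) hintra).symm

end ForestCounting

section Separated

open SimpleGraph

variable {V : Type u} {G : SimpleGraph V}

theorem exists_adj_edist_eq {s t : V} (hst : G.Reachable s t) {i : ℕ} (hi : i < G.edist s t) :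
    ∃ a b, G.Adj a b ∧ G.edist s a = i ∧ G.edist s b = (i + 1 : ℕ) := by
  obtain ⟨p, hp⟩ := hst.exists_walk_length_eq_dist
  rw [← hst.coe_dist_eq_edist, ← hp, Nat.cast_lt] at hi
  have hgeodesic : ∀ j ≤ p.length, G.edist s (p.getVert j) = j := by
    intro j hj
    rw [← (p.take j).reachable.coe_dist_eq_edist,
      ← length_eq_dist_of_subwalk hp (p.isSubwalk_take j), Walk.take_length, min_eq_left hj]
  exact ⟨_, _, p.adj_getVert_succ hi, hgeodesic i hi.le, hgeodesic (i + 1) hi⟩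

theorem ncard_sub_card_connectedComponent_le [Finite V] (G : SimpleGraph V) (S : Set V) :
    S.ncard - Nat.card G.ConnectedComponent ≤
      {s ∈ S | ∃ t ∈ S, s ≠ t ∧ G.Reachable s t}.ncard := by
  set M : Set V := {s ∈ S | ∃ t ∈ S, s ≠ t ∧ G.Reachable s t}
  have hinj : Set.InjOn G.connectedComponentMk (S \ M) := fun s hs t ht hst => by
    by_contra hne
    exact hs.2 ⟨hs.1, t, ht.1, hne, ConnectedComponent.exact hst⟩
  have hle := Set.ncard_le_ncard_of_injOn (t := Set.univ) _ (fun _ _ => trivial) hinj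
  have hsplit := Set.ncard_sdiff_add_ncard_of_subset (show M ⊆ S from Set.sep_subset S _)
  rw [Set.ncard_univ] at hle
  omega

theorem ncard_sub_card_connectedComponent_mul_le [Finite V] {S : Set V} {ρ : ℕ}
    (hS : S.Pairwise fun u v => (2 * ρ : ℕ) < G.edist u v) :
    (S.ncard - Nat.card G.ConnectedComponent) * ρ ≤ G.edgeSet.ncard := by
  let M : Set V := {s ∈ S | ∃ t ∈ S, s ≠ t ∧ G.Reachable s t}
  have hedge (s : M) (i : Fin ρ) :
      ∃ a b, G.Adj a b ∧ G.edist s a = (i : ℕ) ∧ G.edist s b = (i + 1 : ℕ) := by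
    obtain ⟨s, hs, t, ht, hne, hst⟩ := s
    refine exists_adj_edist_eq hst (lt_trans ?_ (hS hs ht hne))
    exact Nat.cast_lt.2 (by omega)
  choose a b hab ha hb using hedge
  have hvertex {s s' : M} {x : V} {i j : ℕ} (hi : i ≤ ρ) (hj : j ≤ ρ) (hx : G.edist s x = i)
      (hx' : G.edist s' x = j) : s = s' ∧ i = j := by
    obtain rfl : s = s' := by
      by_contra hne
      refine (hS s.2.1 s'.2.1 (Subtype.coe_ne_coe.2 hne)).not_ge
        ((G.edist_triangle (v := x)).trans ?_)
      rw [hx, edist_comm, hx', ← Nat.cast_add]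
      exact Nat.cast_le.2 (by omega)
    exact ⟨rfl, Nat.cast_injective (hx.symm.trans hx')⟩
  have hinj : Function.Injective fun x : M × Fin ρ =>
      (⟨s(a x.1 x.2, b x.1 x.2), hab x.1 x.2⟩ : G.edgeSet) := by
    rintro ⟨s, i⟩ ⟨s', j⟩ h
    obtain ⟨haa, -⟩ | ⟨hab', hba'⟩ := Sym2.eq_iff.1 (congrArg Subtype.val h)
    · obtain ⟨rfl, hij⟩ := hvertex i.2.le j.2.le (ha s i) (haa ▸ ha s' j)
      rw [Fin.ext hij]
    · have hij := (hvertex i.2.le j.2 (ha s i) (hab' ▸ hb s' j)).2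
      have hji := (hvertex i.2 j.2.le (hb s i) (hba' ▸ ha s' j)).2
      omega
  have hcard := Nat.card_le_card_of_injective _ hinj
  rw [Nat.card_prod, Nat.card_fin] at hcard
  exact (Nat.mul_le_mul_right ρ (ncard_sub_card_connectedComponent_le G S)).trans hcard

end Separated

section RulingSets

open SimpleGraph

variable {V : Type u} {G : SimpleGraph V} {X Y : Set V} {k l : ℕ}

/-- The closed neighbourhood of radius `k` of a set of vertices, in the graph metric. -/
def graphThickening (G : SimpleGraph V) (X : Set V) (k : ℕ) : Set V :=
  {v | ∃ u ∈ X, G.edist u v ≤ k}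

theorem graphThickening_zero : graphThickening G X 0 = X := by
  ext v
  simp [graphThickening]

theorem graphThickening_mono_left (hXY : X ⊆ Y) : graphThickening G X k ⊆ graphThickening G Y k :=
  fun _ ⟨u, hu, hd⟩ => ⟨u, hXY hu, hd⟩

theorem graphThickening_mono_right (hkl : k ≤ l) : graphThickening G X k ⊆ graphThickening G X l :=
  fun _ ⟨u, hu, hd⟩ => ⟨u, hu, hd.trans (Nat.cast_le.2 hkl)⟩

theorem graphThickening_graphThickening_subset :
    graphThickening G (graphThickening G X k) l ⊆ graphThickening G X (k + l) := by
  rintro v ⟨w, ⟨u, hu, huw⟩, hwv⟩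
  exact ⟨u, hu, SimpleGraph.edist_triangle.trans <|
    (add_le_add huw hwv).trans_eq (Nat.cast_add k l).symm⟩

theorem mem_graphThickening_succ_iff {v : V} :
    v ∈ graphThickening G X (k + 1) ↔
      v ∈ graphThickening G X k ∨ ∃ w, G.Adj v w ∧ w ∈ graphThickening G X k := by
  constructor
  · rintro ⟨u, hu, hd⟩
    obtain ⟨p, hp⟩ := exists_walk_of_edist_ne_top
      (ne_top_of_le_ne_top (ENat.natCast_ne_top _) hd)
    rw [← hp, Nat.cast_le] at hd
    by_cases hnil : p.Nil
    · exact .inl ⟨u, hu, by simp [hnil.eq]⟩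
    · refine .inr ⟨p.penultimate, (p.adj_penultimate hnil).symm, u, hu, ?_⟩
      exact (edist_le p.dropLast).trans (Nat.cast_le.2 (by rw [Walk.length_dropLast]; omega))
  · rintro (h | ⟨w, hvw, hw⟩)
    · exact graphThickening_mono_right k.le_succ h
    · refine graphThickening_graphThickening_subset ⟨w, hw, ?_⟩
      exact (edist_eq_one_iff_adj.2 hvw.symm).le

/-- The candidates that remain after the first `j` phases of a bitwise elimination: in phase `j`
those whose identifier has `j`-th bit `1` drop out if they are within distance `r` of a candidate
with `j`-th bit `0`. -/
def rulingSet (G : SimpleGraph V) (ident : V → ℕ) (r : ℕ) : ℕ → Set V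
  | 0 => Set.univ
  | j + 1 => {v ∈ rulingSet G ident r j | (ident v).testBit j = false ∨
      v ∉ graphThickening G {u ∈ rulingSet G ident r j | (ident u).testBit j = false} r}

/-- The candidates of phase `j` whose `j`-th bit is `0`; in this phase they start a flood. -/
def floodSources (G : SimpleGraph V) (ident : V → ℕ) (r j : ℕ) : Set V :=
  {u ∈ rulingSet G ident r j | (ident u).testBit j = false}

variable {ident : V → ℕ} {r L : ℕ}

theorem rulingSet_antitone : Antitone (rulingSet G ident r) :=
  antitone_nat_of_succ_le fun _ _ hv => hv.1

theorem mem_graphThickening_rulingSet (v : V) (L : ℕ) :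
    v ∈ graphThickening G (rulingSet G ident r L) (L * r) := by
  induction L with
  | zero => rw [Nat.zero_mul, graphThickening_zero]; trivial
  | succ L ih =>
    have hphase : rulingSet G ident r L ⊆ graphThickening G (rulingSet G ident r (L + 1)) r := by
      intro u hu
      have hstay : floodSources G ident r L ⊆ rulingSet G ident r (L + 1) :=
        fun w hw => ⟨hw.1, .inl hw.2⟩
      by_cases hnear : u ∈ graphThickening G (floodSources G ident r L) r
      · exact graphThickening_mono_left hstay hnear
      · exact graphThickening_mono_right r.zero_le (graphThickening_zero.ge ⟨hu, .inr hnear⟩)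
    rw [Nat.succ_mul, Nat.add_comm (L * r)]
    exact graphThickening_graphThickening_subset (graphThickening_mono_left hphase ih)

theorem lt_edist_of_testBit_ne {u v : V} (hu : u ∈ rulingSet G ident r L)
    (hv : v ∈ rulingSet G ident r L) {j : ℕ} (hj : j < L)
    (hbit : (ident u).testBit j ≠ (ident v).testBit j) : (r : ℕ∞) < G.edist u v := by
  wlog huj : (ident u).testBit j = false generalizing u v
  · rw [edist_comm]
    exact this hv hu hbit.symm (by simp_all)
  have hvj : (ident v).testBit j ≠ false := fun h => hbit (huj.trans h.symm)
  have hfar := (rulingSet_antitone (Nat.succ_le_of_lt hj) hv).2.resolve_left hvj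
  by_contra! hd
  exact hfar ⟨u, ⟨rulingSet_antitone hj.le hu, huj⟩, hd⟩

theorem floodSources_eq_rulingSet (hL : ∀ v, ident v < 2 ^ L) :
    floodSources G ident r L = rulingSet G ident r L :=
  Set.sep_eq_self_iff_mem_true.2 fun v _ => Nat.testBit_lt_two_pow (hL v)

theorem rulingSet_pairwise (hinj : Function.Injective ident) (hL : ∀ v, ident v < 2 ^ L) :
    (rulingSet G ident r L).Pairwise fun u v => (r : ℕ∞) < G.edist u v := by
  intro u hu v hv huv
  obtain ⟨j, hj⟩ : ∃ j, (ident u).testBit j ≠ (ident v).testBit j := by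
    by_contra! h
    exact huv (hinj (Nat.eq_of_testBit_eq h))
  refine lt_edist_of_testBit_ne hu hv ?_ hj
  by_contra! hLj
  have hzero (w : V) : (ident w).testBit j = false :=
    Nat.testBit_lt_two_pow ((hL w).trans_le (Nat.pow_le_pow_right two_pos hLj))
  exact hj ((hzero u).trans (hzero v).symm)

end RulingSets

section ParentForests

open SimpleGraph

variable {V : Type u} {G : SimpleGraph V} {par : V → V} {lev : V → ℕ}

/-- The graph that joins every vertex to its parent; roots are their own parents. -/
def parentGraph (par : V → V) : SimpleGraph V :=
  SimpleGraph.fromRel fun v w => par v = w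

theorem edist_parentGraph_parent_le (v : V) : (parentGraph par).edist v (par v) ≤ 1 :=
  edist_le_one_iff_adj_or_eq.2 (or_iff_not_imp_right.2 fun hne => ⟨hne, .inl rfl⟩)

theorem edist_parentGraph_iterate_le (v : V) (k : ℕ) :
    (parentGraph par).edist v (par^[k] v) ≤ k := by
  induction k with
  | zero => simp
  | succ k ih =>
    rw [Function.iterate_succ_apply', Nat.cast_succ]
    exact SimpleGraph.edist_triangle.trans (add_le_add ih (edist_parentGraph_parent_le _))

/-- The parent of every non-root is a neighbour of smaller level. -/
def IsParentMap (G : SimpleGraph V) (par : V → V) (lev : V → ℕ) : Prop :=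
  ∀ v, par v ≠ v → G.Adj v (par v) ∧ lev (par v) < lev v

namespace IsParentMap

theorem parentGraph_le (h : IsParentMap G par lev) : parentGraph par ≤ G := by
  rintro v w ⟨hne, rfl | rfl⟩
  · exact (h v hne.symm).1
  · exact (h w hne).1.symm

theorem isAcyclic (h : IsParentMap G par lev) : (parentGraph par).IsAcyclic := by
  classical
  intro v c hc
  obtain ⟨x, hx, hmax⟩ := c.support.toFinset.exists_max_image lev ⟨v, by simp⟩
  rw [List.mem_toFinset] at hx
  have hcycle := hc.rotate hx
  -- Both neighbours of a vertex of maximal level on the cycle are its parent.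
  have hpar : ∀ y ∈ (c.rotate x hx).support, (parentGraph par).Adj x y → par x = y := by
    rintro y hy ⟨hne, hxy | rfl⟩
    · exact hxy
    · have hle := hmax y (List.mem_toFinset.2 ((Walk.mem_support_rotate_iff ..).1 hy))
      exact absurd (h y hne).2 hle.not_gt
  apply hcycle.snd_ne_penultimate
  exact (hpar _ (Walk.getVert_mem_support ..) (Walk.adj_snd hcycle.not_nil)).symm.trans
    (hpar _ (Walk.getVert_mem_support ..) (Walk.adj_penultimate hcycle.not_nil).symm)

theorem parent_iterate (h : IsParentMap G par lev) {v : V} {k : ℕ} (hk : lev v ≤ k) :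
    par (par^[k] v) = par^[k] v := by
  induction k generalizing v with
  | zero =>
    by_contra hne
    exact absurd (h v hne).2 (by omega)
  | succ k ih =>
    rw [Function.iterate_succ_apply]
    by_cases hroot : par v = v
    · rw [hroot, Function.iterate_fixed hroot, hroot]
    · exact ih (by have := (h v hroot).2; omega)

theorem iterate_eq_of_reachable (h : IsParentMap G par lev) {B : ℕ} (hB : ∀ v, lev v ≤ B)
    {u v : V} (huv : (parentGraph par).Reachable u v) : par^[B] u = par^[B] v := by
  have hparent (v : V) : par^[B] (par v) = par^[B] v := by
    rw [← Function.iterate_succ_apply, Function.iterate_succ_apply', h.parent_iterate (hB v)]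
  obtain ⟨p⟩ := huv
  induction p with
  | nil => rfl
  | cons hadj _ ih =>
    obtain ⟨-, rfl | rfl⟩ := hadj
    · rw [← ih, hparent]
    · rw [← ih, hparent]

theorem dist_le (h : IsParentMap G par lev) {B : ℕ} (hB : ∀ v, lev v ≤ B) {u v : V}
    (huv : (parentGraph par).Reachable u v) : (parentGraph par).dist u v ≤ 2 * B := by
  have hv := edist_parentGraph_iterate_le (par := par) v B
  rw [← h.iterate_eq_of_reachable hB huv, edist_comm] at hv
  have hd := SimpleGraph.edist_triangle.trans (add_le_add (edist_parentGraph_iterate_le u B) hv)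
  rw [← huv.coe_dist_eq_edist, ← Nat.cast_add, Nat.cast_le] at hd
  omega

theorem card_connectedComponent_le [Finite V] (h : IsParentMap G par lev) :
    Nat.card (parentGraph par).ConnectedComponent ≤ {v | par v = v}.ncard := by
  refine Nat.card_le_card_of_surjective
    (fun v : {v | par v = v} => (parentGraph par).connectedComponentMk v) fun C => ?_
  obtain ⟨v, rfl⟩ := C.exists_rep
  refine ⟨⟨par^[lev v] v, h.parent_iterate le_rfl⟩, ConnectedComponent.sound ?_⟩
  exact (reachable_of_edist_ne_top (ne_top_of_le_ne_top (ENat.natCast_ne_top _)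
    (edist_parentGraph_iterate_le v _))).symm

theorem ncard_edgeSet_sdiff_le [Finite V] (h : IsParentMap G par lev) {ρ : ℕ} {ε : ℝ}
    (hρ : 1 ≤ ε * ρ) (hsep : {v | par v = v}.Pairwise fun u v => (2 * ρ : ℕ) < G.edist u v) :
    ((G.edgeSet \ (parentGraph par).edgeSet).ncard : ℝ) ≤
      deletionDist CycleFree.{u} G + ε * G.edgeSet.ncard := by
  let excess := {v | par v = v}.ncard - Nat.card G.ConnectedComponent
  have hε : 0 ≤ ε := by
    by_contra! hneg
    exact absurd hρ (by nlinarith [Nat.cast_nonneg (α := ℝ) ρ])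
  have hcut : ((G.edgeSet \ (parentGraph par).edgeSet).ncard : ℝ) ≤
      deletionDist CycleFree.{u} G + excess := by
    have hforest := ncard_edgeSet_sdiff_add_card_connectedComponent_le h.parentGraph_le h.isAcyclic
    have hroots := h.card_connectedComponent_le
    exact_mod_cast (by omega : (G.edgeSet \ (parentGraph par).edgeSet).ncard ≤
      deletionDist CycleFree.{u} G + excess)
  have hexcess : ((excess * ρ : ℕ) : ℝ) ≤ G.edgeSet.ncard :=
    Nat.cast_le.2 (ncard_sub_card_connectedComponent_mul_le hsep)
  have hslack : (excess : ℝ) ≤ ε * G.edgeSet.ncard := by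
    calc (excess : ℝ) ≤ ε * ρ * excess := le_mul_of_one_le_left (Nat.cast_nonneg _) hρ
      _ = ε * (excess * ρ : ℕ) := by push_cast; ring
      _ ≤ ε * G.edgeSet.ncard := mul_le_mul_of_nonneg_left hexcess hε
  linarith

end IsParentMap

end ParentForests

section Algorithm

/-- The state of a processor during the flooding algorithm: the current phase and the number of
rounds it has lasted, the identifier and the degree, whether the processor is still a candidate,
whether the current flood has reached it, the port through which the flood arrived, and which ports
lead to processors that have announced this one as their parent. -/
structure CorrectorState where
  phase : ℕ
  step : ℕ
  ident : ℕ
  degree : ℕ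
  cand : Bool
  reached : Bool
  parent : Option ℕ
  child : ℕ → Bool

/-- The first port through which a message beginning with the bit `1` arrives. -/
def firstPort (degree : ℕ) (inbox : ℕ → List Bool) : Option ℕ :=
  (List.range degree).find? fun p => (inbox p).getD 0 false

namespace CorrectorState

/-- The message of a processor: has the flood reached it, and is the receiver its parent? -/
def message (s : CorrectorState) (p : ℕ) : List Bool :=
  [s.reached, decide (s.parent = some p)]

/-- Does the processor remain a candidate at the end of a phase? -/
def survives (s : CorrectorState) : Bool :=
  s.cand && (!s.ident.testBit s.phase || !s.reached)

/-- The transition to the next phase, in which a new flood starts. -/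
def beginPhase (s : CorrectorState) : CorrectorState :=
  { s with
    phase := s.phase + 1
    step := 0
    cand := s.survives
    reached := s.survives && !s.ident.testBit (s.phase + 1)
    parent := none }

/-- The transition in which the flood of the current phase advances by one edge. -/
def listen (s : CorrectorState) (inbox : ℕ → List Bool) : CorrectorState :=
  { s with
    step := s.step + 1
    reached := s.reached || (firstPort s.degree inbox).isSome
    parent := if s.reached then s.parent else firstPort s.degree inbox
    child := fun p => (inbox p).getD 1 false }

/-- A link is deleted unless one of its ends is the parent of the other. -/
def deletes (s : CorrectorState) (p : ℕ) : Bool :=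
  !(decide (s.parent = some p) || s.child p)

end CorrectorState

/-- In `L` phases with floods of radius `r`, a ruling set is computed from the bits of the
identifiers. In the last phase a flood of radius `L * r` grows breadth-first trees from its
elements; one more round tells the parents their children, and all links outside of the trees are
deleted. -/
def corrector (L r : ℕ) : CongestAlgorithm where
  tapeLength := 0
  State := CorrectorState
  init ident degree _ :=
    { phase := 0, step := 0, ident := ident, degree := degree, cand := true,
      reached := !ident.testBit 0, parent := none, child := fun _ => false }
  send := CorrectorState.message
  receive s inbox := if s.phase < L ∧ s.step = r then s.beginPhase else s.listen inbox
  rounds := L * (r + 1) + L * r + 1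
  output := CorrectorState.deletes

namespace Network

variable {V : Type u} (N : Network V)

theorem inbox_port (out : V → ℕ → List Bool) (v : V) (p : Fin (N.graph.neighborSet v).ncard) :
    N.inbox out v p =
      out (N.port v p) ((N.port (N.port v p)).symm ⟨v, (N.port v p).2.symm⟩ : Fin _) :=
  dif_pos p.2

/-- The messages that `v` receives when the states of the processors are `σ`. -/
noncomputable def messages (σ : V → CorrectorState) (v : V) : ℕ → List Bool :=
  N.inbox (fun u => (σ u).message) v

/-- The processors that the flood of phase `j` has reached after `i` rounds. -/
def flooded (r j i : ℕ) : Set V :=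
  graphThickening N.graph (floodSources N.graph N.ident r j) i

/-- The number of rounds after which the flood of phase `j` reaches a processor. -/
noncomputable def floodLevel (r j : ℕ) (v : V) : ℕ :=
  sInf {i | v ∈ N.flooded r j i}

/-- The parent of a processor, or the processor itself if it has none. -/
noncomputable def parentOf (σ : V → CorrectorState) (v : V) : V :=
  (σ v).parent.elim v fun p =>
    if h : p < (N.graph.neighborSet v).ncard then N.port v ⟨p, h⟩ else v

variable {N} {σ : V → CorrectorState} {r j i : ℕ}

theorem flooded_zero : N.flooded r j 0 = floodSources N.graph N.ident r j :=
  graphThickening_zero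

theorem flooded_mono : Monotone (N.flooded r j) :=
  fun _ _ hkl => graphThickening_mono_right hkl

theorem port_ne (v : V) (p : Fin (N.graph.neighborSet v).ncard) : (N.port v p : V) ≠ v :=
  (N.graph.ne_of_adj (N.port v p).2).symm

theorem parentOf_eq_port_iff {v : V} (p : Fin (N.graph.neighborSet v).ncard) :
    N.parentOf σ v = N.port v p ↔ (σ v).parent = some (p : ℕ) := by
  unfold parentOf
  cases (σ v).parent with
  | none => simpa using (port_ne v p).symm
  | some q =>
    by_cases hq : q < (N.graph.neighborSet v).ncard
    · rw [Option.elim_some, dif_pos hq, Option.some.injEq, Subtype.val_inj,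
        (N.port v).injective.eq_iff, Fin.ext_iff]
    · rw [Option.elim_some, dif_neg hq, Option.some.injEq]
      exact ⟨fun h => absurd h.symm (port_ne v p), fun h => absurd (h ▸ p.2) hq⟩

theorem messages_getD_zero (v : V) (p : Fin (N.graph.neighborSet v).ncard) :
    (N.messages σ v p).getD 0 false = (σ (N.port v p)).reached := by
  rw [messages, inbox_port]
  rfl

theorem messages_getD_one_eq_true_iff (v : V) (p : Fin (N.graph.neighborSet v).ncard) :
    (N.messages σ v p).getD 1 false = true ↔ N.parentOf σ (N.port v p) = v := by
  have hport := parentOf_eq_port_iff (N := N) (σ := σ)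
    ((N.port (N.port v p)).symm ⟨v, (N.port v p).2.symm⟩)
  rw [Equiv.apply_symm_apply] at hport
  rw [hport, messages, inbox_port]
  exact decide_eq_true_iff

theorem isSome_firstPort_messages_iff (v : V) :
    (firstPort (N.degree v) (N.messages σ v)).isSome = true ↔
      ∃ w, N.graph.Adj v w ∧ (σ w).reached = true := by
  simp only [firstPort, List.find?_isSome, List.mem_range]
  constructor
  · rintro ⟨p, hp, hmsg⟩
    exact ⟨_, (N.port v ⟨p, hp⟩).2, (messages_getD_zero v ⟨p, hp⟩).symm.trans hmsg⟩
  · rintro ⟨w, hvw, hw⟩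
    refine ⟨((N.port v).symm ⟨w, hvw⟩ : Fin _), Fin.is_lt _, ?_⟩
    rw [messages_getD_zero, Equiv.apply_symm_apply, hw]

theorem reached_of_firstPort_messages_eq_some {v : V} {p : ℕ}
    (hp : firstPort (N.degree v) (N.messages σ v) = some p) :
    ∃ h : p < (N.graph.neighborSet v).ncard, (σ (N.port v ⟨p, h⟩)).reached = true := by
  have hlt := List.mem_range.1 (List.mem_of_find?_eq_some hp)
  have hmsg := List.find?_some (p := fun p => (N.messages σ v p).getD 0 false) hp
  exact ⟨hlt, (messages_getD_zero v ⟨p, hlt⟩).symm.trans hmsg⟩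

end Network

/-- The states `σ` are those after `i` rounds of phase `j`. The level of a parent in the flood is
smaller than that of its children: there is a round `k` after which only the parent is reached. -/
structure IsFloodState {V : Type u} (N : Network V) (r j i : ℕ) (σ : V → CorrectorState) :
    Prop where
  phase : ∀ v, (σ v).phase = j
  step : ∀ v, (σ v).step = i
  ident : ∀ v, (σ v).ident = N.ident v
  degree : ∀ v, (σ v).degree = N.degree v
  cand : ∀ v, (σ v).cand = true ↔ v ∈ rulingSet N.graph N.ident r j
  reached : ∀ v, (σ v).reached = true ↔ v ∈ N.flooded r j i
  parent_none : ∀ v, (σ v).parent = none → v ∈ N.flooded r j i →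
    v ∈ floodSources N.graph N.ident r j
  parent_some : ∀ v p, (σ v).parent = some p → ∃ h : p < (N.graph.neighborSet v).ncard,
    ∃ k, (N.port v ⟨p, h⟩ : V) ∈ N.flooded r j k ∧ v ∉ N.flooded r j k

namespace IsFloodState

variable {V : Type u} {N : Network V} {r j i L : ℕ} {σ : V → CorrectorState}

theorem init (tape : V → Fin (corrector L r).tapeLength → Bool) :
    IsFloodState N r 0 0 ((corrector L r).stateAfter N tape 0) where
  phase _ := rfl
  step _ := rfl
  ident _ := rfl
  degree _ := rfl
  cand v := iff_of_true rfl (Set.mem_univ v)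
  reached v := by
    rw [Network.flooded_zero]
    exact (Bool.not_eq_true' _).to_iff.trans (and_iff_right (Set.mem_univ v)).symm
  parent_none v _ hv := Network.flooded_zero.le hv
  parent_some _ _ hp := nomatch hp

theorem survives_iff (h : IsFloodState N r j r σ) (v : V) :
    (σ v).survives = true ↔ v ∈ rulingSet N.graph N.ident r (j + 1) := by
  rw [CorrectorState.survives, Bool.and_eq_true, Bool.or_eq_true, Bool.not_eq_true',
    Bool.not_eq_true', ← Bool.not_eq_true (σ v).reached, h.cand, h.reached, h.ident, h.phase]
  rfl

theorem beginPhase (h : IsFloodState N r j r σ) :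
    IsFloodState N r (j + 1) 0 fun v => (σ v).beginPhase where
  phase v := congrArg (· + 1) (h.phase v)
  step _ := rfl
  ident := h.ident
  degree := h.degree
  cand := h.survives_iff
  reached v := by
    rw [Network.flooded_zero, CorrectorState.beginPhase, Bool.and_eq_true, h.survives_iff,
      Bool.not_eq_true', h.phase, h.ident]
    rfl
  parent_none v _ hv := Network.flooded_zero.le hv
  parent_some _ _ hp := nomatch hp

theorem reached_listen_iff (h : IsFloodState N r j i σ) (v : V) :
    ((σ v).listen (N.messages σ v)).reached = true ↔ v ∈ N.flooded r j (i + 1) := by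
  rw [CorrectorState.listen, Bool.or_eq_true, h.degree, Network.isSome_firstPort_messages_iff,
    h.reached]
  simp only [h.reached]
  exact mem_graphThickening_succ_iff.symm

theorem parent_listen_of_mem_flooded (h : IsFloodState N r j i σ) {v : V}
    (hv : v ∈ N.flooded r j i) : ((σ v).listen (N.messages σ v)).parent = (σ v).parent :=
  if_pos ((h.reached v).2 hv)

theorem parent_listen_of_notMem_flooded (h : IsFloodState N r j i σ) {v : V}
    (hv : v ∉ N.flooded r j i) :
    ((σ v).listen (N.messages σ v)).parent = firstPort (N.degree v) (N.messages σ v) := by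
  rw [← h.degree]
  exact if_neg (mt (h.reached v).1 hv)

theorem listen (h : IsFloodState N r j i σ) :
    IsFloodState N r j (i + 1) fun v => (σ v).listen (N.messages σ v) where
  phase := h.phase
  step v := congrArg (· + 1) (h.step v)
  ident := h.ident
  degree := h.degree
  cand := h.cand
  reached := h.reached_listen_iff
  parent_none v hnone hv := by
    by_cases hold : v ∈ N.flooded r j i
    · rw [h.parent_listen_of_mem_flooded hold] at hnone
      exact h.parent_none v hnone hold
    · rw [h.parent_listen_of_notMem_flooded hold] at hnone
      have hreached := (h.reached_listen_iff v).2 hv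
      rw [CorrectorState.listen, Bool.or_eq_true, h.reached, h.degree, hnone] at hreached
      exact absurd hreached (by simpa using hold)
  parent_some v p hsome := by
    by_cases hold : v ∈ N.flooded r j i
    · rw [h.parent_listen_of_mem_flooded hold] at hsome
      exact h.parent_some v p hsome
    · rw [h.parent_listen_of_notMem_flooded hold] at hsome
      obtain ⟨hp, hreached⟩ := Network.reached_of_firstPort_messages_eq_some hsome
      exact ⟨hp, i, (h.reached _).1 hreached, hold⟩

theorem stateAfter_succ_eq_beginPhase {tape : V → Fin (corrector L r).tapeLength → Bool} {t : ℕ}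
    (h : IsFloodState N r j r ((corrector L r).stateAfter N tape t)) (hj : j < L) :
    (corrector L r).stateAfter N tape (t + 1) =
      fun v => CorrectorState.beginPhase ((corrector L r).stateAfter N tape t v) :=
  funext fun v => if_pos ⟨(h.phase v).trans_lt hj, h.step v⟩

theorem stateAfter_succ_eq_listen {tape : V → Fin (corrector L r).tapeLength → Bool} {t : ℕ}
    (h : IsFloodState N r j i ((corrector L r).stateAfter N tape t)) (hi : j < L → i ≠ r) :
    (corrector L r).stateAfter N tape (t + 1) =
      fun v => CorrectorState.listen ((corrector L r).stateAfter N tape t v)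
        (N.messages ((corrector L r).stateAfter N tape t) v) :=
  funext fun v => if_neg fun hv => hi ((h.phase v).symm.trans_lt hv.1) ((h.step v).symm.trans hv.2)

theorem stateAfter_add {tape : V → Fin (corrector L r).tapeLength → Bool} {t : ℕ}
    (h : IsFloodState N r j 0 ((corrector L r).stateAfter N tape t)) (hi : j < L → i ≤ r) :
    IsFloodState N r j i ((corrector L r).stateAfter N tape (t + i)) := by
  induction i with
  | zero => exact h
  | succ i ih =>
    have hflood := ih fun hj => (Nat.le_succ i).trans (hi hj)
    rw [← Nat.add_assoc, hflood.stateAfter_succ_eq_listen fun hj => (Nat.lt_of_succ_le (hi hj)).ne]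
    exact hflood.listen

theorem stateAfter_mul (tape : V → Fin (corrector L r).tapeLength → Bool) (hj : j ≤ L) :
    IsFloodState N r j 0 ((corrector L r).stateAfter N tape (j * (r + 1))) := by
  induction j with
  | zero => rw [Nat.zero_mul]; exact init tape
  | succ j ih =>
    have hflood := (ih (Nat.le_of_succ_le hj)).stateAfter_add fun _ => le_rfl
    rw [Nat.succ_mul, ← Nat.add_assoc, hflood.stateAfter_succ_eq_beginPhase hj]
    exact hflood.beginPhase

theorem isParentMap (h : IsFloodState N r j i σ) (hall : ∀ v, v ∈ N.flooded r j i) :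
    IsParentMap N.graph (N.parentOf σ) (N.floodLevel r j) := by
  intro v hv
  cases hpar : (σ v).parent with
  | none => exact absurd (by rw [Network.parentOf, hpar, Option.elim_none]) hv
  | some p =>
    obtain ⟨hp, k, hpk, hvk⟩ := h.parent_some v p hpar
    rw [(Network.parentOf_eq_port_iff ⟨p, hp⟩).2 hpar]
    refine ⟨(N.port v ⟨p, hp⟩).2, (Nat.sInf_le hpk).trans_lt ?_⟩
    have hlevel : v ∈ N.flooded r j (N.floodLevel r j v) :=
      Nat.sInf_mem (s := {i | v ∈ N.flooded r j i}) ⟨i, hall v⟩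
    by_contra! hle
    exact hvk (Network.flooded_mono hle hlevel)

theorem mem_floodSources (h : IsFloodState N r j i σ) (hall : ∀ v, v ∈ N.flooded r j i) {v : V}
    (hv : N.parentOf σ v = v) : v ∈ floodSources N.graph N.ident r j := by
  cases hpar : (σ v).parent with
  | none => exact h.parent_none v hpar (hall v)
  | some p =>
    obtain ⟨hp, -⟩ := h.parent_some v p hpar
    rw [(Network.parentOf_eq_port_iff ⟨p, hp⟩).2 hpar] at hv
    exact absurd hv (Network.port_ne v _)

theorem deletes_listen_iff (h : IsFloodState N r j i σ) (hall : ∀ v, v ∈ N.flooded r j i) (v : V)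
    (p : Fin (N.graph.neighborSet v).ncard) :
    ((σ v).listen (N.messages σ v)).deletes p = true ↔
      s(v, (N.port v p : V)) ∈ N.graph.edgeSet \ (parentGraph (N.parentOf σ)).edgeSet := by
  have hchild : ((σ v).listen (N.messages σ v)).child p = true ↔ N.parentOf σ (N.port v p) = v :=
    Network.messages_getD_one_eq_true_iff v p
  rw [CorrectorState.deletes, Bool.not_eq_true', ← Bool.not_eq_true, Bool.or_eq_true,
    decide_eq_true_iff, h.parent_listen_of_mem_flooded (hall v), hchild,
    ← Network.parentOf_eq_port_iff]
  exact ⟨fun hdel => ⟨(N.port v p).2, fun hedge => hdel hedge.2⟩,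
    fun hedge hdel => hedge.2 ⟨(Network.port_ne v p).symm, hdel⟩⟩

end IsFloodState

theorem corrector_corrects {V : Type u} [Finite V] (N : Network V) {L ρ : ℕ} {ε d : ℝ}
    (hρ : 1 ≤ ε * ρ) (hL : ∀ v, N.ident v < 2 ^ L) (hd : 2 * ((L * (2 * ρ) : ℕ) : ℝ) ≤ d)
    (tape : V → Fin (corrector L (2 * ρ)).tapeLength → Bool) :
    ∃ D, (corrector L (2 * ρ)).Corrects N CycleFree.{u} ε tape D ∧
      IsClusterTreeDeletion N.graph d D := by
  have hstate := (IsFloodState.stateAfter_mul (N := N) tape le_rfl).stateAfter_add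
    (i := L * (2 * ρ)) fun h => absurd h (lt_irrefl L)
  set σ := (corrector L (2 * ρ)).stateAfter N tape (L * (2 * ρ + 1) + L * (2 * ρ))
  have hall (v : V) : v ∈ N.flooded (2 * ρ) L (L * (2 * ρ)) := by
    rw [Network.flooded, floodSources_eq_rulingSet hL]
    exact mem_graphThickening_rulingSet v L
  have hpar := hstate.isParentMap hall
  have hroots : {v | N.parentOf σ v = v} ⊆ rulingSet N.graph N.ident (2 * ρ) L := fun v hv =>
    floodSources_eq_rulingSet hL ▸ hstate.mem_floodSources hall hv
  have hdist (u v : V) (huv : (parentGraph (N.parentOf σ)).Reachable u v) :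
      ((parentGraph (N.parentOf σ)).dist u v : ℝ) ≤ d :=
    (Nat.cast_le.2 (hpar.dist_le (fun v => Nat.sInf_le (hall v)) huv)).trans (by exact_mod_cast hd)
  refine ⟨_, ⟨Set.sdiff_subset, fun v p => ?_, ?_, hpar.ncard_edgeSet_sdiff_le hρ
    ((rulingSet_pairwise N.ident_injective hL).mono hroots)⟩,
    isClusterTreeDeletion_sdiff_edgeSet hpar.parentGraph_le hpar.isAcyclic hdist⟩
  · rw [← hstate.deletes_listen_iff hall]
    exact (congrArg (CorrectorState.deletes · p = true) (congrFun
      (hstate.stateAfter_succ_eq_listen fun h => absurd h (lt_irrefl L)) v)).to_iff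
  · rw [SimpleGraph.deleteEdges_sdiff_eq_of_le hpar.parentGraph_le]
    exact hpar.isAcyclic

end Algorithm

theorem CongestAlgorithm.tapeProb_eq_one {V : Type u} [Finite V] (A : CongestAlgorithm)
    {event : Set (V → Fin A.tapeLength → Bool)} (h : ∀ tape, tape ∈ event) :
    A.tapeProb event = 1 := by
  rw [tapeProb, Set.eq_univ_of_forall h, Set.ncard_univ]
  exact div_self (Nat.cast_ne_zero.2 Nat.card_pos.ne')

section Parameters

/-- The algorithm without communication that deletes every edge. -/
def deleteAll : CongestAlgorithm where
  tapeLength := 0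
  State := Unit
  init _ _ _ := ()
  send _ _ := []
  receive _ _ := ()
  rounds := 0
  output _ _ := true

theorem deleteAll_corrects {V : Type u} [Finite V] (N : Network V) {ε : ℝ}
    (h : Nat.card V < 2 ∨ 1 ≤ ε) (tape : V → Fin deleteAll.tapeLength → Bool) :
    deleteAll.Corrects N CycleFree.{u} ε tape N.graph.edgeSet := by
  refine ⟨subset_rfl, fun v i => iff_of_true rfl (N.port v i).2, ?_, ?_⟩
  · rw [SimpleGraph.deleteEdges_eq_bot.2 subset_rfl]
    exact SimpleGraph.isAcyclic_bot
  · refine le_add_of_nonneg_of_le (Nat.cast_nonneg _) ?_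
    obtain hcard | hε := h
    · have : Subsingleton V := Finite.card_le_one_iff_subsingleton.1 (Nat.lt_succ_iff.1 hcard)
      simp [Subsingleton.elim N.graph ⊥]
    · exact le_mul_of_one_le_left (Nat.cast_nonneg _) hε

theorem isClusterTreeDeletion_edgeSet {V : Type u} (G : SimpleGraph V) {d : ℝ} (hd : 0 ≤ d) :
    IsClusterTreeDeletion G d G.edgeSet := by
  have hdist (u v : V) (huv : (⊥ : SimpleGraph V).Reachable u v) :
      ((⊥ : SimpleGraph V).dist u v : ℝ) ≤ d := by
    obtain rfl := SimpleGraph.reachable_bot.1 huv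
    simpa using hd
  simpa using isClusterTreeDeletion_sdiff_edgeSet bot_le SimpleGraph.isAcyclic_bot hdist

/-- The corrector for `n` processors with identifiers below `n ^ κ`: floods of radius `2 * ⌈1 / ε⌉`,
in one phase for each bit of the identifiers. -/
noncomputable def cycleFreeCorrector (κ n : ℕ) (ε : ℝ) : CongestAlgorithm :=
  open Classical in
  if 2 ≤ n ∧ ε < 1 then corrector (κ * Nat.clog 2 n) (2 * ⌈1 / ε⌉₊) else deleteAll

variable {κ n : ℕ} {ε : ℝ}

theorem one_le_two_mul_log (hn : 2 ≤ n) : 1 ≤ 2 * Real.log n := by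
  have hlog : Real.log 2 ≤ Real.log n := Real.log_le_log two_pos (by exact_mod_cast hn)
  linarith [Real.log_two_gt_d9]

theorem clog_two_le (hn : 2 ≤ n) : (Nat.clog 2 n : ℝ) ≤ 4 * Real.log n := by
  have hlogb : Real.logb 2 n ≤ 2 * Real.log n := by
    rw [Real.logb, div_le_iff₀ (Real.log_pos one_lt_two)]
    nlinarith [Real.log_two_gt_d9, Real.log_natCast_nonneg n]
  have hceil := Nat.ceil_lt_add_one (Real.logb_nonneg (b := 2) (x := n) one_lt_two
    (by exact_mod_cast (by omega : 1 ≤ n)))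
  rw [show ⌈Real.logb 2 n⌉₊ = Nat.clog 2 n by exact_mod_cast Real.natCeil_logb_natCast 2 n] at hceil
  linarith [one_le_two_mul_log hn]

theorem one_le_mul_ceil_one_div (hε : 0 < ε) : 1 ≤ ε * (⌈1 / ε⌉₊ : ℝ) := by
  rw [← div_le_iff₀' hε]
  exact Nat.le_ceil _

theorem ceil_one_div_le (hε : 0 < ε) (hε1 : ε < 1) : (⌈1 / ε⌉₊ : ℝ) ≤ 2 / ε :=
  calc (⌈1 / ε⌉₊ : ℝ) ≤ 1 / ε + 1 := (Nat.ceil_lt_add_one (one_div_pos.2 hε).le).le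
    _ ≤ 1 / ε + 1 / ε := by gcongr; exact (one_lt_one_div hε hε1).le
    _ = 2 / ε := by ring

theorem phases_mul_radius_le (κ : ℕ) (hn : 2 ≤ n) (hε : 0 < ε) (hε1 : ε < 1) :
    ((κ * Nat.clog 2 n * (2 * ⌈1 / ε⌉₊) : ℕ) : ℝ) ≤ 16 * κ * (Real.log n / ε) := by
  push_cast
  calc (κ * Nat.clog 2 n * (2 * ⌈1 / ε⌉₊) : ℝ)
      ≤ κ * (4 * Real.log n) * (2 * (2 / ε)) := by
        gcongr
        exacts [clog_two_le hn, ceil_one_div_le hε hε1]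
    _ = 16 * κ * (Real.log n / ε) := by ring

theorem corrector_rounds_le {L r : ℕ} (hr : 1 ≤ r) : (corrector L r).rounds ≤ 3 * (L * r) + 1 := by
  have hL : L ≤ L * r := Nat.le_mul_of_pos_right L hr
  change L * (r + 1) + L * r + 1 ≤ _
  linarith

theorem cycleFreeCorrector_tapeLength : (cycleFreeCorrector κ n ε).tapeLength = 0 := by
  unfold cycleFreeCorrector
  split_ifs <;> rfl

theorem cycleFreeCorrector_rounds_le (κ n : ℕ) (hε : 0 < ε) :
    ((cycleFreeCorrector κ n ε).rounds : ℝ) ≤ (48 * κ + 4) * (Real.log n / ε) := by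
  unfold cycleFreeCorrector
  split_ifs with h
  · obtain ⟨hn, hε1⟩ := h
    have hrounds := corrector_rounds_le (L := κ * Nat.clog 2 n) (r := 2 * ⌈1 / ε⌉₊)
      (by have := Nat.ceil_pos.2 (one_div_pos.2 hε); omega)
    have hlog : 1 ≤ 2 * (Real.log n / ε) := by
      rw [← mul_div_assoc, one_le_div hε]
      exact hε1.le.trans (one_le_two_mul_log hn)
    calc ((corrector (κ * Nat.clog 2 n) (2 * ⌈1 / ε⌉₊)).rounds : ℝ)
        ≤ 3 * (κ * Nat.clog 2 n * (2 * ⌈1 / ε⌉₊) : ℕ) + 1 := by exact_mod_cast hrounds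
      _ ≤ (48 * κ + 4) * (Real.log n / ε) := by
        linarith [phases_mul_radius_le κ hn hε hε1]
  · exact Nat.cast_zero.trans_le (by positivity)

theorem cycleFreeCorrector_bandwidthAtMost (κ n : ℕ) (ε : ℝ) :
    (cycleFreeCorrector κ n ε).BandwidthAtMost ((48 * κ + 4) * Real.log n) := by
  unfold cycleFreeCorrector
  split_ifs with h
  · intro s p
    change ((2 : ℕ) : ℝ) ≤ _
    have hκ : 0 ≤ κ * Real.log n := by positivity
    push_cast
    linarith [one_le_two_mul_log h.1]
  · exact fun _ _ => Nat.cast_zero.trans_le (by positivity)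

theorem cycleFreeCorrector_corrects {V : Type u} [Finite V] (N : Network V) (hε : 0 < ε)
    (hV : Nat.card V = n) (hident : ∀ v, N.ident v < n ^ κ)
    (tape : V → Fin (cycleFreeCorrector κ n ε).tapeLength → Bool) :
    ∃ D, (cycleFreeCorrector κ n ε).Corrects N CycleFree.{u} ε tape D ∧
      IsClusterTreeDeletion N.graph ((48 * κ + 4) * (Real.log n / ε)) D := by
  have hlog : 0 ≤ Real.log n / ε := by positivity
  revert tape
  by_cases h : 2 ≤ n ∧ ε < 1
  · rw [cycleFreeCorrector, if_pos h]
    refine corrector_corrects N (one_le_mul_ceil_one_div hε) (fun v => (hident v).trans_le ?_) ?_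
    · rw [Nat.mul_comm, pow_mul]
      exact Nat.pow_le_pow_left (Nat.le_pow_clog one_lt_two n) κ
    · linarith [phases_mul_radius_le κ h.1 hε h.2, mul_nonneg κ.cast_nonneg hlog]
  · rw [cycleFreeCorrector, if_neg h]
    rw [not_and_or, not_le, not_lt, ← hV] at h
    exact fun tape =>
      ⟨_, deleteAll_corrects N h tape, isClusterTreeDeletion_edgeSet _ (by positivity)⟩

end Parameters

theorem mainTheorem3_general (κ : ℕ) :
    ∃ C : ℝ, 0 < C ∧ ∃ A : ℕ → ℝ → CongestAlgorithm,
      ∀ (n : ℕ) (ε : ℝ), 0 < ε →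
        (A n ε).tapeLength = 0 ∧
        ((A n ε).rounds : ℝ) ≤ C * (Real.log n / ε) ∧
        (A n ε).BandwidthAtMost (C * Real.log n) ∧
        ∀ (V : Type u) [Finite V] (N : Network V), Nat.card V = n →
          (∀ v, N.ident v < n ^ κ) →
          ∀ tape, ∃ D : Set (Sym2 V), (A n ε).Corrects N CycleFree ε tape D ∧
            IsClusterTreeDeletion N.graph (C * (Real.log n / ε)) D :=
  ⟨48 * κ + 4, by positivity, cycleFreeCorrector κ, fun n ε hε =>
    ⟨cycleFreeCorrector_tapeLength, cycleFreeCorrector_rounds_le κ n hε,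
      cycleFreeCorrector_bandwidthAtMost κ n ε,
      fun _ _ N hV hident tape => cycleFreeCorrector_corrects N hε hV hident tape⟩⟩

theorem mainTheorem3 (κ c : ℕ) :
    ∃ C : ℝ, 0 < C ∧ ∃ A : ℕ → ℝ → CongestAlgorithm,
      ∀ (n : ℕ) (ε : ℝ), 0 < ε →
        ((A n ε).rounds : ℝ) ≤ C * (Real.log n / ε) ∧
        (A n ε).BandwidthAtMost (C * Real.log n) ∧
        ∀ (V : Type u) [Finite V] (N : Network V), Nat.card V = n →
          (∀ v, N.ident v < n ^ κ) →
          1 - 1 / (n : ℝ) ^ c ≤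
            (A n ε).tapeProb {tape | ∃ D : Set (Sym2 V),
              (A n ε).Corrects N CycleFree ε tape D ∧
              IsClusterTreeDeletion N.graph (C * (Real.log n / ε)) D} := by
  obtain ⟨C, hC, A, hA⟩ := mainTheorem3_general.{u} κ
  refine ⟨C, hC, A, fun n ε hε => ?_⟩
  obtain ⟨-, hrounds, hbandwidth, hcorrects⟩ := hA n ε hε
  refine ⟨hrounds, hbandwidth, fun V _ N hV hident => ?_⟩
  refine (sub_le_self 1 (by positivity)).trans_eq ((A n ε).tapeProb_eq_one ?_).symm
  exact hcorrects V N hV hident
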